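/- **Theorem.** Let $\mathbb{K}=\mathbb{R}$ or $\mathbb{C}$, let $\Omega,\omega$ be non-empty sets and $\nu\colon\omega\to(0,\infty)$. For every Banach space $E\neq\{0\}$ over $\mathbb{K}$ let $\mathrm{AP}(\Omega,E)$ be a linear subspace of $E^{\Omega}$, $T^{E}\colon E^{\Omega}\supset\operatorname{dom}T^{E}\to E^{\omega}$ a linear map, and let $F(\Omega,E):=\mathrm{AP}(\Omega,E)\cap\operatorname{dom}T^{E}$ carry a locally convex Hausdorff topology. Put $$\mathcal{F}\nu(\Omega,E):=\{f\in F(\Omega,E)\;|\;|f|:=\sup_{x\in\omega}\|T^{E}(f)(x)\|\,\nu(x)<\infty\},$$ with the topology of the seminorm $|\cdot|$, and $F(\Omega):=F(\Omega,\mathbb{K})$, $\mathcal{F}\nu(\Omega):=\mathcal{F}\nu(\Omega,\mathbb{K})$, $T^{\mathbb{K}}_{x}(f):=T^{\mathbb{K}}(f)(x)$, $\delta_x(f):=f(x)$. Let $F(\Omega)\varepsilon E$ be the space of continuous linear maps $F(\Omega)'_{\kappa}\to E$ with the topology of uniform convergence on the equicontinuous subsets of $F(\Omega)'$, where $\kappa$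 is the topology of uniform convergence on the absolutely convex compact subsets of $F(\Omega)$. Suppose that for every Banach space $E\neq\{0\}$: * ($\varepsilon$-into-compatibility) $\delta_{x}\in F(\Omega)'$ for all $x\in\Omega$, and $S\colon F(\Omega)\varepsilon E\to F(\Omega,E)$, $S(u)(x):=u(\delta_{x})$, is well defined and a topological isomorphism onto its range; * (generator) $\mathcal{F}\nu(\Omega)$ and $\mathcal{F}\nu(\Omega,E)$ are Hausdorff, and $\delta_{x}\in\mathcal{F}\nu(\Omega)'$ for all $x\in\Omega$; * (consistency) for all $u\in F(\Omega)\varepsilon E$ and $x\in\omega$: $S(u)\in F(\Omega,E)$, $T^{\mathbb{K}}_{x}\in F(\Omega)'$ and $T^{E}(S(u))(x)=u(T^{\mathbb{K}}_{x})$; * (strength) for all $e'\in E'$, $f\in F(\Omega,E)$ and $x\in\omega$: $e'\circ f\in F(\Omega)$ and $T^{\mathbb{K}}(e'\circ f)(x)=e'(T^{E}(f)(x))$. Let $F(\Omega)$ be a nuclear Fréchet space, let $\mathcal{F}\nu(\Omega)$ be a Banach space whose closed unit ball is a compact subset of $F(\Omega)$, and let $(x_{n})_{n\in\mathbb{N}}$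 be a sequence in $\omega$ that fixes the topology in $\mathcal{F}\nu(\Omega)$, i.e. there is $C_0>0$ with $|f|\le C_0\sup_{n}|T^{\mathbb{K}}(f)(x_{n})|\nu(x_{n})$ for all $f\in\mathcal{F}\nu(\Omega)$. Then: a) There is $\lambda\in\ell^{1}$ with $\lambda_{n}>0$ for all $n$ such that for every bounded set $B$ in the strong dual $F(\Omega)'_{b}$ there is $C\ge 1$ with $$\{\mu|_{\mathcal{F}\nu(\Omega)}\;|\;\mu\in B\}\subset\Bigl\{\sum_{n=1}^{\infty}a_{n}\nu(x_{n})T^{\mathbb{K}}_{x_{n}}\in\mathcal{F}\nu(\Omega)'\;\Big|\;a\in\ell^{1},\ |a_{n}|\le C\lambda_{n}\text{ for all }n\Bigr\},$$ where the series converge in the norm of $\mathcal{F}\nu(\Omega)'$. b) Let $(\|\cdot\|_{k})_{k\in\mathbb{N}}$ be a sequence of seminorms generating the topology of $F(\Omega)$. Then there is a strictly decreasing sequence $(\varepsilon_{n})_{n\in\mathbb{N}}$ of real numbers converging to $0$ such that for every $k$ there is $C\ge 1$ with $$\|f\|_{k}\le C\sup_{n\in\mathbb{N}}|T^{\mathbb{K}}(f)(x_{n})|\,\nu(x_{n})\,\varepsilon_{n}\qquad\text{for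 all }f\in\mathcal{F}\nu(\Omega).$$ -/

import Mathlib

universe u v w

noncomputable section

/-! ### Locally convex spaces -/

section LocallyConvex

variable (K : Type*) [RCLike K]

/-- Locally convex Hausdorff spaces over `K = ℝ` or `ℂ`: the topology is Hausdorff and is
generated by (all continuous) seminorms. -/
structure IsLCHausdorff (V : Type*) [AddCommGroup V] [Module K V] [TopologicalSpace V] :
    Prop where
  t2Space : T2Space V
  polynormable : PolynormableSpace K V

theorem IsLCHausdorff.isTopologicalAddGroup {V : Type*} [AddCommGroup V] [Module K V]
    [TopologicalSpace V] (h : IsLCHausdorff K V) : IsTopologicalAddGroup V :=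
  h.polynormable.withSeminorms'.topologicalAddGroup

theorem IsLCHausdorff.continuousSMul {V : Type*} [AddCommGroup V] [Module K V]
    [TopologicalSpace V] (h : IsLCHausdorff K V) : ContinuousSMul K V :=
  h.polynormable.withSeminorms'.continuousSMul

/-- Fréchet spaces: Hausdorff topological vector spaces whose topology is generated by a sequence
of seminorms and which are complete for the uniformity of the additive group. -/
structure IsFrechet (V : Type*) [AddCommGroup V] [Module K V] [TopologicalSpace V]
    [IsTopologicalAddGroup V] : Prop where
  t2Space : T2Space V
  exists_seminorms : ∃ p : ℕ → Seminorm K V, WithSeminorms p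
  complete : @CompleteSpace V (IsTopologicalAddGroup.rightUniformSpace V)

variable {K} in
/-- A continuous linear map `A` from a locally convex space into a Banach space is nuclear if
`A v = ∑ cₙ φₙ(v) yₙ` with `(cₙ)` in `ℓ¹`, an equicontinuous sequence `(φₙ)` of linear forms and a
bounded sequence `(yₙ)`. -/
def IsNuclearMap {V Y : Type*} [AddCommGroup V] [Module K V] [TopologicalSpace V]
    [NormedAddCommGroup Y] [NormedSpace K Y] (A : V →L[K] Y) : Prop :=
  ∃ (c : ℕ → K) (φ : ℕ → V →L[K] K) (y : ℕ → Y),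
    Summable (fun n => ‖c n‖) ∧
    Equicontinuous (fun n => (φ n : V → K)) ∧
    Bornology.IsBounded (Set.range y) ∧
    ∀ v : V, HasSum (fun n => c n • φ n v • y n) (A v)

/-- A locally convex space is nuclear if every continuous linear map from it into a Banach space
is nuclear. (The local Banach spaces of `V` live in the same universe as `V`, so restricting to
Banach spaces in that universe loses nothing.) -/
def IsNuclearSpace (V : Type v) [AddCommGroup V] [Module K V] [TopologicalSpace V] : Prop :=
  ∀ (Y : Type v) [NormedAddCommGroup Y] [NormedSpace K Y] [CompleteSpace Y] (A : V →L[K] Y),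
    IsNuclearMap A

/-- Absolutely convex sets. -/
def IsAbsConvex {V : Type*} [AddCommGroup V] [Module K V] (S : Set V) : Prop :=
  ∀ x ∈ S, ∀ y ∈ S, ∀ a b : K, ‖a‖ + ‖b‖ ≤ 1 → a • x + b • y ∈ S

/-- `V'_κ`: the topological dual of `V` with the topology of uniform convergence on the absolutely
convex compact subsets of `V`. -/
abbrev KappaDual (V : Type*) [AddCommGroup V] [Module K V] [TopologicalSpace V] : Type _ :=
  UniformConvergenceCLM (RingHom.id K) K {S : Set V | IsAbsConvex K S ∧ IsCompact S}

/-- Schwartz' `ε`-product `V ε E = L_e(V'_κ, E)`: the continuous linear maps `V'_κ → E` with the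
topology of uniform convergence on the equicontinuous subsets of `V'`. -/
abbrev EpsProduct (V E : Type*) [AddCommGroup V] [Module K V] [TopologicalSpace V]
    [AddCommGroup E] [Module K E] [TopologicalSpace E] : Type _ :=
  UniformConvergenceCLM (RingHom.id K) E
    {H : Set (KappaDual K V) | Equicontinuous (fun φ : H => (φ.1 : V → K))}

variable {K} in
/-- A continuous linear form, regarded as an element of `V'_κ`. -/
def toKappaDual {V : Type*} [AddCommGroup V] [Module K V] [TopologicalSpace V]
    (φ : V →L[K] K) : KappaDual K V := φ

end LocallyConvex

/-! ### The function spaces `F(Ω, E)` and `𝓕ν(Ω, E)` -/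

/-- A linear subspace `AP(Ω, E)` of `E^Ω` and a linear map `T^E : E^Ω ⊇ dom T^E → E^ω`. -/
structure FunctionData (K Ω ω E : Type*) [RCLike K] [NormedAddCommGroup E]
    [NormedSpace K E] where
  AP : Submodule K (Ω → E)
  T : (Ω → E) →ₗ.[K] (ω → E)

/-- The space `F(Ω, E) = AP(Ω, E) ∩ dom T^E`, as a type without a preassigned topology. -/
def FunctionData.Carrier {K Ω ω E : Type*} [RCLike K] [NormedAddCommGroup E]
    [NormedSpace K E] (D : FunctionData K Ω ω E) : Type _ :=
  (D.AP ⊓ D.T.domain : Submodule K (Ω → E))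

instance FunctionData.instAddCommGroupCarrier {K Ω ω E : Type*} [RCLike K]
    [NormedAddCommGroup E] [NormedSpace K E] (D : FunctionData K Ω ω E) :
    AddCommGroup D.Carrier :=
  inferInstanceAs (AddCommGroup (D.AP ⊓ D.T.domain : Submodule K (Ω → E)))

instance FunctionData.instModuleCarrier {K Ω ω E : Type*} [RCLike K]
    [NormedAddCommGroup E] [NormedSpace K E] (D : FunctionData K Ω ω E) :
    Module K D.Carrier :=
  inferInstanceAs (Module K (D.AP ⊓ D.T.domain : Submodule K (Ω → E)))

/-- A space `F(Ω, E) = AP(Ω, E) ∩ dom T^E` of `E`-valued functions on `Ω` with a locally convex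
Hausdorff topology of its own (in general not the topology of pointwise convergence). -/
structure FunctionSpace (K Ω ω E : Type*) [RCLike K] [NormedAddCommGroup E]
    [NormedSpace K E] extends FunctionData K Ω ω E where
  topology : TopologicalSpace toFunctionData.Carrier
  isLCHausdorff : IsLCHausdorff K toFunctionData.Carrier

namespace FunctionSpace

variable {K Ω ω E : Type*} [RCLike K] [NormedAddCommGroup E] [NormedSpace K E]

variable (D : FunctionSpace K Ω ω E)

instance : TopologicalSpace D.Carrier := D.topology

instance : T2Space D.Carrier := D.isLCHausdorff.t2Space

instance : PolynormableSpace K D.Carrier := D.isLCHausdorff.polynormable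

instance : IsTopologicalAddGroup D.Carrier := D.isLCHausdorff.isTopologicalAddGroup

instance : ContinuousSMul K D.Carrier := D.isLCHausdorff.continuousSMul

/-- The membership `g ∈ F(Ω, E)` for a function `g : Ω → E`. -/
def Mem (g : Ω → E) : Prop := g ∈ D.AP ⊓ D.T.domain

variable {D} in
/-- An element of `F(Ω, E)` from a function and a proof of membership. -/
def ofMem (g : Ω → E) (hg : D.Mem g) : D.Carrier := ⟨g, hg⟩

/-- The inclusion `F(Ω, E) ⊆ E^Ω`. -/
def toFun : D.Carrier →ₗ[K] (Ω → E) := (D.AP ⊓ D.T.domain).subtype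

/-- The point evaluation `δ_x` on `F(Ω, E)`. -/
def delta (x : Ω) : D.Carrier →ₗ[K] E := LinearMap.proj x ∘ₗ D.toFun

/-- The map `T^E`, restricted to `F(Ω, E)`. -/
def op : D.Carrier →ₗ[K] (ω → E) :=
  D.T.toFun ∘ₗ Submodule.inclusion (inf_le_right : D.AP ⊓ D.T.domain ≤ D.T.domain)

/-- The map `T^E_x : f ↦ T^E(f)(x)` on `F(Ω, E)`. -/
def opAt (x : ω) : D.Carrier →ₗ[K] E := LinearMap.proj x ∘ₗ D.op

/-- The space `𝓕ν(Ω, E)` of all `f ∈ F(Ω, E)` with `sup_x ‖T^E(f)(x)‖ ν(x) < ∞`, as a linear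
subspace of `F(Ω, E)`. -/
def weighted (ν : ω → Set.Ioi (0 : ℝ)) : Submodule K D.Carrier where
  carrier := {f | BddAbove (Set.range fun x => ‖D.op f x‖ * (ν x : ℝ))}
  zero_mem' := ⟨0, by rintro _ ⟨x, rfl⟩; simp⟩
  add_mem' := by
    rintro f g ⟨a, ha⟩ ⟨b, hb⟩
    refine ⟨a + b, ?_⟩
    rintro _ ⟨x, rfl⟩
    have h1 := ha ⟨x, rfl⟩
    have h2 := hb ⟨x, rfl⟩
    have h3 : ‖D.op (f + g) x‖ ≤ ‖D.op f x‖ + ‖D.op g x‖ := by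
      rw [map_add]; exact norm_add_le _ _
    have h4 := mul_le_mul_of_nonneg_right h3 (ν x).2.out.le
    simp only at h1 h2 ⊢
    linarith
  smul_mem' := by
    rintro c f ⟨a, ha⟩
    refine ⟨‖c‖ * a, ?_⟩
    rintro _ ⟨x, rfl⟩
    have h1 := mul_le_mul_of_nonneg_left (ha ⟨x, rfl⟩) (norm_nonneg c)
    simp only [map_smul, Pi.smul_apply, norm_smul, mul_assoc] at h1 ⊢
    exact h1

/-- The space `𝓕ν(Ω, E)`, as a type that carries only the topology of its own (semi)norm. -/
def Weighted (ν : ω → Set.Ioi (0 : ℝ)) : Type _ := D.weighted ν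

variable (ν : ω → Set.Ioi (0 : ℝ))

instance : AddCommGroup (D.Weighted ν) := inferInstanceAs (AddCommGroup (D.weighted ν))

instance : Module K (D.Weighted ν) := inferInstanceAs (Module K (D.weighted ν))

/-- The inclusion `𝓕ν(Ω, E) ⊆ F(Ω, E)`. -/
def incl : D.Weighted ν →ₗ[K] D.Carrier := (D.weighted ν).subtype

theorem bddAbove_weighted (f : D.Weighted ν) :
    BddAbove (Set.range fun x => ‖D.op (D.incl ν f) x‖ * (ν x : ℝ)) := f.2

/-- The seminorm `|f| = sup_x ‖T^E(f)(x)‖ ν(x)` on `𝓕ν(Ω, E)`. -/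
def weightedSeminorm : Seminorm K (D.Weighted ν) :=
  Seminorm.of (fun f => ⨆ x, ‖D.op (D.incl ν f) x‖ * (ν x : ℝ))
    (by
      intro f g
      have hν : ∀ x, (0 : ℝ) ≤ ν x := fun x => (ν x).2.out.le
      refine Real.iSup_le (fun x => ?_) (add_nonneg
        (Real.iSup_nonneg fun x => mul_nonneg (norm_nonneg _) (hν x))
        (Real.iSup_nonneg fun x => mul_nonneg (norm_nonneg _) (hν x)))
      have h1 := le_ciSup (D.bddAbove_weighted ν f) x
      have h2 := le_ciSup (D.bddAbove_weighted ν g) x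
      have h3 : ‖D.op (D.incl ν (f + g)) x‖
          ≤ ‖D.op (D.incl ν f) x‖ + ‖D.op (D.incl ν g) x‖ := by
        rw [map_add, map_add]; exact norm_add_le _ _
      have h4 := mul_le_mul_of_nonneg_right h3 (hν x)
      linarith)
    (by
      intro c f
      simp only [map_smul, Pi.smul_apply, norm_smul, mul_assoc]
      exact (Real.mul_iSup_of_nonneg (norm_nonneg c) _).symm)

instance : SeminormedAddCommGroup (D.Weighted ν) :=
  (D.weightedSeminorm ν).toAddGroupSeminorm.toSeminormedAddCommGroup

theorem norm_weighted (f : D.Weighted ν) :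
    ‖f‖ = ⨆ x, ‖D.op (D.incl ν f) x‖ * (ν x : ℝ) := rfl

instance : NormedSpace K (D.Weighted ν) where
  norm_smul_le c f := le_of_eq (map_smul_eq_mul (D.weightedSeminorm ν) c f)

theorem norm_opAt_incl_le (x : ω) (f : D.Weighted ν) :
    ‖D.opAt x (D.incl ν f)‖ ≤ (ν x : ℝ)⁻¹ * ‖f‖ := by
  have h : ‖D.opAt x (D.incl ν f)‖ * (ν x : ℝ) ≤ ‖f‖ := le_ciSup (D.bddAbove_weighted ν f) x
  have hν : (0 : ℝ) < ν x := (ν x).2.out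
  rw [inv_mul_eq_div, le_div_iff₀ hν]
  exact h

/-- The continuous linear map `T^E_x` on `𝓕ν(Ω, E)`. -/
def weightedOpAt (x : ω) : D.Weighted ν →L[K] E :=
  LinearMap.mkContinuous (D.opAt x ∘ₗ D.incl ν) (ν x : ℝ)⁻¹ (D.norm_opAt_incl_le ν x)

@[simp]
theorem weightedOpAt_apply (x : ω) (f : D.Weighted ν) :
    D.weightedOpAt ν x f = D.op (D.incl ν f) x := rfl

/-- The closed unit ball of `𝓕ν(Ω, E)`, as a subset of `F(Ω, E)`. -/
def unitBall : Set D.Carrier := D.incl ν '' Metric.closedBall 0 1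

/-- A set `U ⊆ ω` fixes the topology in `𝓕ν(Ω, E)`. -/
def FixesTopology (U : Set ω) : Prop :=
  ∃ C : ℝ, 0 < C ∧ ∀ f : D.Weighted ν, ‖f‖ ≤ C * ⨆ x : U, ‖D.op (D.incl ν f) x‖ * (ν x : ℝ)

end FunctionSpace

/-! ### `ε`-into-compatibility, generators, strong and consistent families -/

section Families

variable {K Ω ω E : Type*} [RCLike K] [NormedAddCommGroup E] [NormedSpace K E]

/-- The map `S : F(Ω) ε E → E^Ω`, `S(u)(x) = u(δ_x)`, for a space `F(Ω)` with continuous point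
evaluations. -/
def epsS (D : FunctionSpace K Ω ω K) (hδ : ∀ x, Continuous (D.delta x))
    (u : EpsProduct K D.Carrier E) : Ω → E :=
  fun x => u (toKappaDual ⟨D.delta x, hδ x⟩)

/-- `F(Ω)` and `F(Ω, E)` are `ε`-into-compatible: the point evaluations of `F(Ω)` are continuous,
and `S` is a well-defined topological isomorphism of `F(Ω) ε E` onto its range in `F(Ω, E)`. -/
def EpsIntoCompatible (D : FunctionSpace K Ω ω K) (DE : FunctionSpace K Ω ω E) : Prop :=
  ∃ hδ : ∀ x, Continuous (D.delta x),
    ∃ hS : ∀ u : EpsProduct K D.Carrier E, DE.Mem (epsS D hδ u),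
      Topology.IsEmbedding
        (fun u : EpsProduct K D.Carrier E => FunctionSpace.ofMem (epsS D hδ u) (hS u))

/-- `(T^E, T^K)` is a generator for `(𝓕ν, E)`: `𝓕ν(Ω)` and `𝓕ν(Ω, E)` are dom-spaces, that is,
both are Hausdorff and the point evaluations of the scalar space are continuous (their topologies
are given by a single seminorm, so there is no directedness to require). -/
structure IsGenerator (D : FunctionSpace K Ω ω K) (DE : FunctionSpace K Ω ω E)
    (ν : ω → Set.Ioi (0 : ℝ)) : Prop where
  t2Space_scalar : T2Space (D.Weighted ν)
  continuous_delta : ∀ x, Continuous (fun f : D.Weighted ν => D.delta x (D.incl ν f))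
  t2Space_vector : T2Space (DE.Weighted ν)

/-- `(T^E, T^K)` is a consistent family for `(F, E)`: for all `u ∈ F(Ω) ε E` and `x ∈ ω`,
`S(u) ∈ F(Ω, E)`, `T^K_x ∈ F(Ω)'` and `T^E(S(u))(x) = u(T^K_x)`. -/
def IsConsistentFamily (D : FunctionSpace K Ω ω K) (DE : FunctionSpace K Ω ω E) : Prop :=
  ∃ hδ : ∀ x, Continuous (D.delta x), ∃ hT : ∀ x, Continuous (D.opAt x),
    ∃ hS : ∀ u : EpsProduct K D.Carrier E, DE.Mem (epsS D hδ u),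
      ∀ (u : EpsProduct K D.Carrier E) (x : ω),
        DE.op (FunctionSpace.ofMem (epsS D hδ u) (hS u)) x = u (toKappaDual ⟨D.opAt x, hT x⟩)

/-- `(T^E, T^K)` is a strong family for `(F, E)`: for all `e' ∈ E'`, `f ∈ F(Ω, E)` and `x ∈ ω`,
`e' ∘ f ∈ F(Ω)` and `T^K(e' ∘ f)(x) = e'(T^E(f)(x))`. -/
def IsStrongFamily (D : FunctionSpace K Ω ω K) (DE : FunctionSpace K Ω ω E) : Prop :=
  ∃ hmem : ∀ (e' : E →L[K] K) (f : DE.Carrier), D.Mem (fun x => e' (DE.toFun f x)),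
    ∀ (e' : E →L[K] K) (f : DE.Carrier) (x : ω),
      D.op (FunctionSpace.ofMem (fun x => e' (DE.toFun f x)) (hmem e' f)) x = e' (DE.op f x)

end Families

end

/-! Let `X` be the weighted space, `V` the nuclear Fréchet space, `j : X → V` the inclusion and `g
n` the form `ν(xₙ) T_{xₙ}` on `X`; these have norm at most 1 and norm `X` up to `C`.

Compactness of the unit ball in `V` puts each restriction `z = φ ∘ j` in the norm closure of the
combinations of the `g n` with coefficient sum at most `C‖z‖`. Otherwise some `Ψ ∈ X''` separates
them; on restrictions of forms on `V` it is evaluation at some `f ∈ X`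
(`exists_eq_eval_of_isCompact`), and the norming property at `f` contradicts the separation
(`exists_finsupp_approx`). Halving the error repeatedly gives `z = ∑ aₙ gₙ` with `∑ ‖aₙ‖ ≤ 2C‖z‖`.

Nuclearity makes the coefficient bounds uniform: all `μ` in the polar of a seminorm are series `∑ cᵢ
yᵢ(μ) φᵢ` with common `c ∈ ℓ¹` and equicontinuous `φᵢ`. Expanding each `φᵢ ∘ j` in the `g n` bounds
the coefficients by a summable sequence independent of `μ` (`exists_coefficient_bound_of_nuclear`).
As countably many seminorms suffice, one sequence `l` serves them all up to constants.

Part a) follows because strongly bounded sets in the dual of a barrelled space are equicontinuous.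
For b), take `ε → 0` with `∑ lₙ/εₙ < ∞`, realise the seminorm at `j f` by a form via Hahn–Banach,
and estimate the series of that form. -/

/-! ### Rearranging and iterating series -/

section SeriesRepresentation

/-- Double series of nonnegative terms with summable row sums. -/
theorem summable_double_of_row_le {F : ℕ → ℕ → ℝ} (h0 : ∀ i n, 0 ≤ F i n)
    (hF : ∀ i, Summable (F i)) {s : ℕ → ℝ} (hs : Summable s) (hle : ∀ i, ∑' n, F i n ≤ s i) :
    (Summable fun p : ℕ × ℕ => F p.1 p.2) ∧ (Summable fun n => ∑' i, F i n) ∧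
      ∀ n, Summable fun i => F i n := by
  have h1 : Summable fun p : ℕ × ℕ => F p.1 p.2 :=
    (summable_prod_of_nonneg fun p => h0 p.1 p.2).2
      ⟨hF, Summable.of_nonneg_of_le (fun i => tsum_nonneg (h0 i)) hle hs⟩
  have h2 : Summable fun p : ℕ × ℕ => F p.2 p.1 := h1.prod_symm
  exact ⟨h1, h2.prod, fun n => h2.prod_factor n⟩

variable {K : Type*} [RCLike K]

/-- Superposition of series `z j = ∑ n, b j n • g n` with bounded `g` and summable coefficients. -/
theorem hasSum_smul_of_hasSum_hasSum {Y : Type*} [NormedAddCommGroup Y] [NormedSpace K Y]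
    [CompleteSpace Y] {g : ℕ → Y} (hg : ∀ n, ‖g n‖ ≤ 1) {b : ℕ → ℕ → K}
    (hb : Summable fun p : ℕ × ℕ => ‖b p.1 p.2‖) {z : ℕ → Y} {s : Y}
    (hz : ∀ j, HasSum (fun n => b j n • g n) (z j)) (hs : HasSum z s) :
    HasSum (fun n => (∑' j, b j n) • g n) s := by
  have hsum : Summable fun p : ℕ × ℕ => b p.1 p.2 • g p.2 := by
    refine Summable.of_norm_bounded hb fun p => ?_
    rw [norm_smul]
    exact mul_le_of_le_one_right (norm_nonneg _) (hg _)
  -- Summing by rows identifies the value of the absolutely convergent double series as `s`; summing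
  -- it by columns then gives the claim.
  have h1 : HasSum (fun p : ℕ × ℕ => b p.1 p.2 • g p.2) s := by
    have h2 := hsum.hasSum.prod_fiberwise (fun j => hz j)
    rw [hs.unique h2]
    exact hsum.hasSum
  have h3 : HasSum (fun p : ℕ × ℕ => b p.2 p.1 • g p.1) s :=
    ((Equiv.prodComm ℕ ℕ).hasSum_iff (f := fun p : ℕ × ℕ => b p.1 p.2 • g p.2)).2 h1
  refine h3.prod_fiberwise fun n => ?_
  have h4 : Summable fun j => b j n := by
    have := (hb.comp_injective (i := fun j : ℕ => (j, n)) fun a b h => by simpa using h)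
    exact this.of_norm
  exact h4.hasSum.smul_const (g n)

/-- A convergent series of finite combinations with summable coefficient norms can be rearranged
into a single series in the `g n`. -/
theorem exists_hasSum_smul_of_finsupp {Y : Type*} [NormedAddCommGroup Y] [NormedSpace K Y]
    [CompleteSpace Y] {g : ℕ → Y} (hg : ∀ n, ‖g n‖ ≤ 1) (d : ℕ → ℕ →₀ K) {s : ℕ → ℝ} {σ : ℝ}
    (hs : HasSum s σ) (hd : ∀ i, (d i).sum (fun _ t => ‖t‖) ≤ s i) {z : Y}
    (hz : HasSum (fun i => (d i).sum fun n t => t • g n) z) :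
    ∃ a : ℕ → K, Summable (fun n => ‖a n‖) ∧ ∑' n, ‖a n‖ ≤ σ ∧ HasSum (fun n => a n • g n) z := by
  have hcoef : ∀ i, HasSum (fun n => ‖d i n‖) ((d i).sum fun _ t => ‖t‖) := fun i =>
    hasSum_sum_of_ne_finset_zero fun n hn => by simp [Finsupp.notMem_support_iff.1 hn]
  have hcoef_le : ∀ i, ∑' n, ‖d i n‖ ≤ s i := fun i => by
    rw [(hcoef i).tsum_eq]
    exact hd i
  have hser : ∀ i, HasSum (fun n => d i n • g n) ((d i).sum fun n t => t • g n) := fun i =>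
    hasSum_sum_of_ne_finset_zero fun n hn => by simp [Finsupp.notMem_support_iff.1 hn]
  obtain ⟨hb, hcol2, hcol1⟩ := summable_double_of_row_le (F := fun i n => ‖d i n‖)
    (fun i n => norm_nonneg _) (fun i => (hcoef i).summable) hs.summable hcoef_le
  have hle : ∀ n, ‖∑' i, d i n‖ ≤ ∑' i, ‖d i n‖ := fun n => norm_tsum_le_tsum_norm (hcol1 n)
  have hsa : Summable fun n => ‖∑' i, d i n‖ :=
    Summable.of_nonneg_of_le (fun n => norm_nonneg _) hle hcol2
  refine ⟨fun n => ∑' i, d i n, hsa, ?_,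
    hasSum_smul_of_hasSum_hasSum (b := fun i n => d i n) hg hb hser hz⟩
  calc ∑' n, ‖∑' i, d i n‖ ≤ ∑' n, ∑' i, ‖d i n‖ := hsa.tsum_le_tsum hle hcol2
    _ = ∑' i, ∑' n, ‖d i n‖ := Summable.tsum_comm (f := fun i n => ‖d i n‖) hb
    _ ≤ ∑' i, s i := hb.prod.tsum_le_tsum hcoef_le hs.summable
    _ = σ := hs.tsum_eq

/-- If every element of `Z` can be approximated up to half of its norm by combinations of the
`g n ∈ Z` with coefficients controlled by the norm, then it is the sum of a series in the `g n`
with absolutely summable coefficients. -/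
theorem exists_hasSum_smul_of_approx {Y : Type*} [NormedAddCommGroup Y] [NormedSpace K Y]
    [CompleteSpace Y] (Z : Submodule K Y) {g : ℕ → Y} (hg : ∀ n, ‖g n‖ ≤ 1)
    (hgZ : ∀ n, g n ∈ Z) {C : ℝ} (hC : 0 ≤ C)
    (h : ∀ z ∈ Z, ∃ c : ℕ →₀ K, c.sum (fun _ t => ‖t‖) ≤ C * ‖z‖ ∧
      ‖z - c.sum fun n t => t • g n‖ ≤ ‖z‖ / 2)
    {z : Y} (hz : z ∈ Z) :
    ∃ a : ℕ → K, Summable (fun n => ‖a n‖) ∧ ∑' n, ‖a n‖ ≤ 2 * C * ‖z‖ ∧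
      HasSum (fun n => a n • g n) z := by
  choose! c hc1 hc2 using h
  -- Successive residuals stay in `Z`, so the approximation can be applied again; their norms decay
  -- like `2⁻ⁱ`, and the geometric sum produces the factor 2.
  let step : Y → Y := fun y => y - (c y).sum fun n t => t • g n
  let r : ℕ → Y := fun i => step^[i] z
  have hr0 : r 0 = z := rfl
  have hrs : ∀ i, r (i + 1) = r i - (c (r i)).sum fun n t => t • g n := fun i =>
    Function.iterate_succ_apply' step i z
  have hrZ : ∀ i, r i ∈ Z := by
    intro i
    induction i with
    | zero => exact hz
    | succ i ih =>
      rw [hrs]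
      exact Z.sub_mem ih (Z.sum_mem fun n _ => Z.smul_mem _ (hgZ n))
  have hrn : ∀ i, ‖r i‖ ≤ ‖z‖ * (1 / 2) ^ i := by
    intro i
    induction i with
    | zero => simp [hr0]
    | succ i ih =>
      rw [hrs, pow_succ]
      have := hc2 _ (hrZ i)
      linarith
  have hgeo : HasSum (fun i : ℕ => C * (‖z‖ * (1 / 2 : ℝ) ^ i)) (2 * C * ‖z‖) := by
    rw [show 2 * C * ‖z‖ = C * (‖z‖ * 2) by ring]
    exact (hasSum_geometric_two.mul_left ‖z‖).mul_left C
  have hd : ∀ i, (c (r i)).sum (fun _ t => ‖t‖) ≤ C * (‖z‖ * (1 / 2 : ℝ) ^ i) := fun i =>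
    (hc1 _ (hrZ i)).trans (mul_le_mul_of_nonneg_left (hrn i) hC)
  have hz' : HasSum (fun i => (c (r i)).sum fun n t => t • g n) z := by
    have hsm : Summable fun i => (c (r i)).sum fun n t => t • g n := by
      refine Summable.of_norm_bounded (g := fun i => C * (‖z‖ * (1 / 2 : ℝ) ^ i)) hgeo.summable
        fun i => ?_
      refine (norm_sum_le _ _).trans (le_trans (Finset.sum_le_sum fun n _ => ?_)
        (hd i))
      rw [norm_smul]
      exact mul_le_of_le_one_right (norm_nonneg _) (hg _)
    rw [hsm.hasSum_iff_tendsto_nat]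
    have htel : ∀ m, ∑ i ∈ Finset.range m, ((c (r i)).sum fun n t => t • g n) = z - r m := by
      intro m
      induction m with
      | zero => simp [hr0]
      | succ m ih => rw [Finset.sum_range_succ, ih, hrs]; abel
    simp_rw [htel]
    have hr : Filter.Tendsto r Filter.atTop (nhds 0) := by
      refine squeeze_zero_norm hrn ?_
      simpa using (tendsto_pow_atTop_nhds_zero_of_lt_one (r := (1 / 2 : ℝ)) (by norm_num)
        (by norm_num)).const_mul ‖z‖
    simpa using hr.const_sub z
  exact exists_hasSum_smul_of_finsupp hg (fun i => c (r i)) hgeo hd hz'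

end SeriesRepresentation

/-! ### Duality from the compact unit ball -/

section CompactBall

variable {K : Type*} [RCLike K] {V : Type*} [AddCommGroup V] [Module K V] [TopologicalSpace V]
  {X : Type*} [NormedAddCommGroup X] [NormedSpace K X]

/-- A linear map with compact image of the unit ball is continuous. -/
theorem continuous_of_isCompact_image_closedBall [IsTopologicalAddGroup V]
    [ContinuousSMul K V] (j : X →ₗ[K] V)
    (hj : IsCompact (j '' Metric.closedBall 0 1)) : Continuous j :=
  (j.clmOfExistsBoundedImage ⟨_, Metric.closedBall_mem_nhds 0 one_pos,
    hj.isVonNBounded K⟩).continuous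

/-- A real upper bound for the real part on the unit ball bounds the norm of a functional. -/
theorem norm_le_of_re_le {l : X →L[K] K} {u : ℝ}
    (h : ∀ f : X, ‖f‖ ≤ 1 → RCLike.re (l f) ≤ u) : ‖l‖ ≤ u := by
  have hu : 0 ≤ u := by simpa using h 0 (by simp)
  refine ContinuousLinearMap.opNorm_le_of_unit_norm hu fun f hf => ?_
  -- A rotation by a unimodular scalar makes the value real and nonnegative.
  obtain ⟨c, hc, hcf⟩ := RCLike.exists_norm_eq_mul_self (l f)
  have := h (c • f) (by simp [norm_smul, hc, hf])
  rwa [map_smul, smul_eq_mul, ← hcf, RCLike.ofReal_re] at this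

/-- If the unit ball of `X` is compact in `V`, then a linear form on `V'` bounded by the norm of
the restrictions to `X` is the evaluation at a point of `X`. -/
theorem exists_eq_eval_of_isCompact (j : X →L[K] V)
    (hj : IsCompact (j '' Metric.closedBall 0 1)) (ψ : (V →L[K] K) →ₗ[K] K)
    (hψ : ∀ φ : V →L[K] K, ‖ψ φ‖ ≤ ‖φ.comp j‖) :
    ∃ f : X, ∀ φ : V →L[K] K, φ (j f) = ψ φ := by
  classical
  -- By compactness it is enough to match `ψ` on finitely many forms; this is a separation argument
  -- in `K^s`.
  have hfin : ∀ s : Finset (V →L[K] K),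
      ∃ v ∈ j '' Metric.closedBall 0 1, ∀ φ ∈ s, φ v = ψ φ := by
    intro s
    let L : X →L[K] (s → K) := ContinuousLinearMap.pi fun i => i.1.comp j
    have himg : L '' Metric.closedBall 0 1 =
        (fun v (i : s) => i.1 v) '' (j '' Metric.closedBall 0 1) := by
      rw [← Set.image_comp]; rfl
    have hcpt : IsCompact (L '' Metric.closedBall 0 1) := by
      rw [himg]
      exact hj.image (continuous_pi fun i => i.1.continuous)
    have hconv : Convex ℝ (L '' Metric.closedBall 0 1) := by
      rintro _ ⟨f, hf, rfl⟩ _ ⟨g, hg, rfl⟩ a b ha hb hab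
      refine ⟨(a : K) • f + (b : K) • g, ?_, ?_⟩
      · rw [mem_closedBall_zero_iff] at hf hg ⊢
        refine (norm_add_le _ _).trans ?_
        rw [norm_smul, norm_smul, RCLike.norm_of_nonneg ha, RCLike.norm_of_nonneg hb, ← hab]
        exact add_le_add (mul_le_of_le_one_right ha hf) (mul_le_of_le_one_right hb hg)
      · rw [map_add, map_smul, map_smul]
        ext i
        simp [RCLike.real_smul_eq_coe_mul]
    by_cases hmem : (fun i : s => ψ i.1) ∈ L '' Metric.closedBall 0 1
    · obtain ⟨f, hf, hfe⟩ := hmem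
      exact ⟨j f, ⟨f, hf, rfl⟩, fun φ hφ => congrFun hfe ⟨φ, hφ⟩⟩
    · exfalso
      obtain ⟨l, u, hl1, hl2⟩ :=
        RCLike.geometric_hahn_banach_closed_point (𝕜 := K) hconv hcpt.isClosed hmem
      -- The separating functional on `K^s` comes from one form `Φ` on `V`. Then `‖Φ ∘ j‖ ≤ u < re
      -- (ψ Φ)`, against the bound on `ψ`.
      let Φ : V →L[K] K := ∑ i : s, l (Pi.single i 1) • i.1
      have hl : ∀ w : s → K, l w = ∑ i, l (Pi.single i 1) * w i := by
        intro w
        have := LinearMap.pi_apply_eq_sum_univ (l : (s → K) →ₗ[K] K) w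
        simp only [ContinuousLinearMap.coe_coe, smul_eq_mul] at this
        rw [this]
        refine Finset.sum_congr rfl fun i _ => ?_
        rw [mul_comm]
        congr 2
        ext k
        simp [Pi.single_apply, eq_comm]
      have hLΦ : ∀ f, l (L f) = Φ (j f) := by
        intro f
        rw [hl]
        simp [Φ, L]
      have hψΦ : l (fun i : s => ψ i.1) = ψ Φ := by
        rw [hl]
        simp [Φ, map_sum]
      have h1 : ‖Φ.comp j‖ ≤ u := norm_le_of_re_le fun f hf => by
        have := hl1 _ ⟨f, mem_closedBall_zero_iff.2 hf, rfl⟩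
        rw [hLΦ] at this
        exact this.le
      have h2 := (RCLike.re_le_norm (ψ Φ)).trans ((hψ Φ).trans h1)
      rw [hψΦ] at hl2
      exact absurd hl2 (not_lt.2 h2)
  have := hj.inter_iInter_nonempty (fun φ : V →L[K] K => {v | φ v = ψ φ})
    (fun φ => isClosed_eq φ.continuous continuous_const) (fun s => by
      obtain ⟨v, hv, hvs⟩ := hfin s
      exact ⟨v, hv, by simpa using hvs⟩)
  obtain ⟨_, ⟨f, _, rfl⟩, hf⟩ := this
  exact ⟨f, fun φ => Set.mem_iInter.1 hf φ⟩

/-- The restrictions to `X` of continuous linear forms on `V` are approximated by finite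
combinations of a norming sequence of such restrictions. -/
theorem exists_finsupp_approx (j : X →L[K] V) (hj : IsCompact (j '' Metric.closedBall 0 1))
    {g : ℕ → X →L[K] K} {C : ℝ} (hC : 0 ≤ C)
    (hfix : ∀ f : X, ‖f‖ ≤ C * ⨆ n, ‖g n f‖)
    (hgj : ∀ n, ∃ t : V →L[K] K, g n = t.comp j) (φ : V →L[K] K) :
    ∃ c : ℕ →₀ K, c.sum (fun _ t => ‖t‖) ≤ C * ‖φ.comp j‖ ∧
      ‖φ.comp j - c.sum fun n t => t • g n‖ ≤ ‖φ.comp j‖ / 2 := by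
  set z := φ.comp j with hz
  -- For `z ≠ 0` the tolerance `‖z‖ / 2` is positive, so membership in a closure suffices.
  rcases (norm_nonneg z).eq_or_lt with h0 | h0
  · exact ⟨0, by simp [← h0], by simp [← h0]⟩
  let D : Set (X →L[K] K) :=
    {y | ∃ c : ℕ →₀ K, c.sum (fun _ t => ‖t‖) ≤ C * ‖z‖ ∧ Finsupp.linearCombination K g c = y}
  suffices hD : z ∈ closure D by
    obtain ⟨_, ⟨c, hc, rfl⟩, hzc⟩ := Metric.mem_closure_iff.1 hD (‖z‖ / 2) (half_pos h0)
    exact ⟨c, hc, by simpa [dist_eq_norm, Finsupp.linearCombination_apply] using hzc.le⟩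
  by_contra hD
  have hconv : Convex ℝ D := by
    rintro _ ⟨c, hc, rfl⟩ _ ⟨d, hd, rfl⟩ a b ha hb hab
    refine ⟨(a : K) • c + (b : K) • d, ?_, ?_⟩
    · have hsum : ∀ e : ℕ →₀ K, ∀ s : Finset ℕ, e.support ⊆ s →
          e.sum (fun _ t => ‖t‖) = ∑ n ∈ s, ‖e n‖ := fun e s hs =>
        Finsupp.sum_of_support_subset _ hs _ (by simp)
      have hs : ((a : K) • c + (b : K) • d).support ⊆ c.support ∪ d.support :=
        Finsupp.support_add.trans
          (Finset.union_subset_union Finsupp.support_smul Finsupp.support_smul)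
      rw [hsum _ _ hs]
      rw [hsum c (c.support ∪ d.support) Finset.subset_union_left] at hc
      rw [hsum d (c.support ∪ d.support) Finset.subset_union_right] at hd
      calc ∑ n ∈ c.support ∪ d.support, ‖((a : K) • c + (b : K) • d) n‖
          ≤ ∑ n ∈ c.support ∪ d.support, (a * ‖c n‖ + b * ‖d n‖) := by
            refine Finset.sum_le_sum fun n _ => (norm_add_le _ _).trans (le_of_eq ?_)
            rw [Finsupp.smul_apply, Finsupp.smul_apply, norm_smul, norm_smul,
              RCLike.norm_of_nonneg ha, RCLike.norm_of_nonneg hb]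
        _ = a * ∑ n ∈ c.support ∪ d.support, ‖c n‖ +
            b * ∑ n ∈ c.support ∪ d.support, ‖d n‖ := by
            rw [Finset.sum_add_distrib, Finset.mul_sum, Finset.mul_sum]
        _ ≤ a * (C * ‖z‖) + b * (C * ‖z‖) := by gcongr
        _ = C * ‖z‖ := by rw [← add_mul, hab, one_mul]
    · rw [map_add, map_smul, map_smul]
      congr 1 <;> ext f <;> simp [RCLike.real_smul_eq_coe_mul]
  obtain ⟨Ψ, u, hΨ1, hΨ2⟩ := RCLike.geometric_hahn_banach_closed_point (𝕜 := K)
    hconv.closure isClosed_closure hD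
  obtain ⟨f, hf⟩ : ∃ f : X, ∀ φ : V →L[K] K, φ (j f) = Ψ (φ.comp j) := by
    -- Dividing by `M` meets the norm bound of the evaluation lemma, and the point found is scaled
    -- back; the `+ 1` keeps `M` nonzero.
    let M : ℝ := ‖Ψ‖ + 1
    have hM : 0 < M := by positivity
    have hMK : (M : K) ≠ 0 := by exact_mod_cast hM.ne'
    let ψ : (V →L[K] K) →ₗ[K] K :=
      { toFun := fun φ => (M : K)⁻¹ * Ψ (φ.comp j)
        map_add' := fun a b => by rw [ContinuousLinearMap.add_comp, map_add, mul_add]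
        map_smul' := fun a b => by
          rw [ContinuousLinearMap.smul_comp, map_smul, smul_eq_mul, RingHom.id_apply, smul_eq_mul]
          ring }
    obtain ⟨f, hf⟩ := exists_eq_eval_of_isCompact j hj ψ fun φ => by
      change ‖(M : K)⁻¹ * Ψ (φ.comp j)‖ ≤ _
      rw [norm_mul, norm_inv, RCLike.norm_of_nonneg hM.le, inv_mul_le_iff₀ hM]
      refine (Ψ.le_opNorm _).trans ?_
      gcongr
      simp [M]
    refine ⟨(M : K) • f, fun φ => ?_⟩
    rw [map_smul, map_smul, hf, smul_eq_mul]
    exact mul_inv_cancel_left₀ hMK _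
  have hu : ∀ n, C * ‖z‖ * ‖g n f‖ ≤ u := by
    intro n
    obtain ⟨t, ht⟩ := hgj n
    obtain ⟨c, hc, hcf⟩ := RCLike.exists_norm_eq_mul_self (g n f)
    -- A single `g n` carries the whole coefficient budget `C‖z‖`, with the phase that turns `g n f`
    -- into its modulus.
    have hmem : ((C * ‖z‖ : ℝ) : K) • c • g n ∈ D := by
      refine ⟨Finsupp.single n (((C * ‖z‖ : ℝ) : K) * c), ?_, ?_⟩
      · rw [Finsupp.sum_single_index (by simp), norm_mul, hc, mul_one,
          RCLike.norm_of_nonneg (by positivity)]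
      · rw [Finsupp.linearCombination_single, mul_smul]
    have h1 := hΨ1 _ (subset_closure hmem)
    have h2 : Ψ (g n) = g n f := by rw [ht, ← hf t]; rfl
    rw [map_smul Ψ, map_smul Ψ, h2, smul_eq_mul, smul_eq_mul, ← hcf, ← RCLike.ofReal_mul,
      RCLike.ofReal_re] at h1
    exact h1.le
  have h1 : ‖z‖ * ‖f‖ ≤ u := by
    calc ‖z‖ * ‖f‖ ≤ ‖z‖ * (C * ⨆ n, ‖g n f‖) := by gcongr; exact hfix f
      _ = ⨆ n, C * ‖z‖ * ‖g n f‖ := by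
        rw [← Real.mul_iSup_of_nonneg (by positivity)]; ring
      _ ≤ u := ciSup_le hu
  have h2 : RCLike.re (Ψ z) ≤ ‖z‖ * ‖f‖ := by
    rw [hz, ← hf φ]
    exact (RCLike.re_le_norm _).trans ((φ.comp j).le_opNorm f)
  linarith

/-- The restrictions to `X` of continuous linear forms on `V` are sums of series in a norming
sequence of such restrictions, with absolutely summable coefficients. -/
theorem exists_hasSum_smul_of_isCompact (j : X →L[K] V)
    (hj : IsCompact (j '' Metric.closedBall 0 1))
    {g : ℕ → X →L[K] K} {C : ℝ} (hC : 0 ≤ C) (hg : ∀ n, ‖g n‖ ≤ 1)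
    (hfix : ∀ f : X, ‖f‖ ≤ C * ⨆ n, ‖g n f‖)
    (hgj : ∀ n, ∃ t : V →L[K] K, g n = t.comp j) (φ : V →L[K] K) :
    ∃ a : ℕ → K, Summable (fun n => ‖a n‖) ∧ ∑' n, ‖a n‖ ≤ 2 * C * ‖φ.comp j‖ ∧
      HasSum (fun n => a n • g n) (φ.comp j) := by
  let R : (V →L[K] K) →ₗ[K] (X →L[K] K) :=
    { toFun := fun φ => φ.comp j
      map_add' := fun _ _ => rfl
      map_smul' := fun _ _ => rfl }
  refine exists_hasSum_smul_of_approx (Y := X →L[K] K) (LinearMap.range R) hg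
    (fun n => ?_) hC ?_ ⟨φ, rfl⟩
  · obtain ⟨t, ht⟩ := hgj n
    exact ⟨t, ht.symm⟩
  rintro _ ⟨φ, rfl⟩
  exact exists_finsupp_approx j hj hC hfix hgj φ

end CompactBall

/-! ### Nuclear expansions, barrelledness and Hahn–Banach -/

section Nuclear

variable {K : Type u} [RCLike K]

open scoped ENNReal in
/-- In a nuclear space, the forms in the polar of a continuous seminorm have a common nuclear
expansion with bounded coefficients. -/
theorem IsNuclearSpace.exists_expansion {V : Type (max u v)} [AddCommGroup V] [Module K V]
    [TopologicalSpace V] [IsTopologicalAddGroup V]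
    (hV : IsNuclearSpace K V) {q : Seminorm K V} (hq : Continuous q) :
    ∃ (c : ℕ → K) (φ : ℕ → V →L[K] K) (M : ℝ), Summable (fun n => ‖c n‖) ∧
      Equicontinuous (fun n => (φ n : V → K)) ∧ 0 ≤ M ∧
      ∀ μ : V →L[K] K, (∀ v, ‖μ v‖ ≤ q v) → ∃ y : ℕ → K, (∀ n, ‖y n‖ ≤ M) ∧
        ∀ v, HasSum (fun n => c n * φ n v * y n) (μ v) := by
  let B : Set (V →L[K] K) := {μ | ∀ v, ‖μ v‖ ≤ q v}
  -- Mapping into the bounded functions on the whole polar `B` gives one expansion for all `μ`,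
  -- recovered coordinatewise. The universe of `V` is such that this target is admissible in
  -- `IsNuclearSpace`.
  let A : V →ₗ[K] lp (fun _ : B => K) ∞ :=
    { toFun := fun v => ⟨fun μ => μ.1 v, memℓp_infty ⟨q v, by
        rintro _ ⟨μ, rfl⟩
        exact μ.2 v⟩⟩
      map_add' := fun v w => by ext μ; exact map_add μ.1 v w
      map_smul' := fun a v => by ext μ; exact map_smul μ.1 a v }
  have hA : ∀ v, ‖A v‖ ≤ q v := fun v =>
    lp.norm_le_of_forall_le (apply_nonneg q v) fun μ => μ.2 v
  have hAc : Continuous A := by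
    refine continuous_of_continuousAt_zero A ?_
    rw [ContinuousAt, map_zero]
    exact squeeze_zero_norm hA (by simpa using hq.tendsto 0)
  obtain ⟨c, φ, y, hc, hφ, hy, hsum⟩ := hV _ (⟨A, hAc⟩ : V →L[K] lp (fun _ : B => K) ∞)
  obtain ⟨M, hM⟩ := hy.exists_norm_le
  refine ⟨c, φ, M, hc, hφ, (norm_nonneg _).trans (hM _ ⟨0, rfl⟩), fun μ hμ => ?_⟩
  refine ⟨fun n => y n ⟨μ, hμ⟩, fun n => ?_, fun v => ?_⟩
  · exact (lp.norm_apply_le_norm ENNReal.top_ne_zero (y n) ⟨μ, hμ⟩).trans (hM _ ⟨n, rfl⟩)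
  · have : HasSum (fun n => c n * (φ n v * y n ⟨μ, hμ⟩)) (μ v) :=
      (hsum v).mapL (lp.evalCLM K (fun _ : B => K) ∞ ⟨μ, hμ⟩)
    simpa only [mul_assoc] using this

variable {V : Type*} [AddCommGroup V] [Module K V] [TopologicalSpace V]

/-- A pointwise bounded family of forms on a barrelled space is dominated by a continuous
seminorm. -/
theorem exists_continuous_seminorm_of_pointwise_bounded [BarrelledSpace K V] {ι : Type*}
    (μ : ι → V →L[K] K) (h : ∀ v, BddAbove (Set.range fun i => ‖μ i v‖)) :
    ∃ q : Seminorm K V, Continuous q ∧ ∀ i v, ‖μ i v‖ ≤ q v := by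
  let p : ι → Seminorm K V := fun i => (normSeminorm K K).comp (μ i).toLinearMap
  have hp : BddAbove (Set.range p) := by
    rw [Seminorm.bddAbove_range_iff]
    exact h
  refine ⟨⨆ i, p i, ?_, fun i v => (le_ciSup hp i : p i ≤ _) v⟩
  -- Barrelledness enters here: a pointwise bounded supremum of continuous seminorms is continuous.
  have := Seminorm.continuous_iSup p (fun i => (μ i).continuous.norm) hp
  rwa [← Seminorm.coe_iSup_eq hp] at this

/-- Fréchet spaces are barrelled. -/
theorem IsFrechet.barrelledSpace [IsTopologicalAddGroup V] (hV : IsFrechet K V) :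
    BarrelledSpace K V := by
  obtain ⟨p, hp⟩ := hV.exists_seminorms
  let : UniformSpace V := IsTopologicalAddGroup.rightUniformSpace V
  have : IsUniformAddGroup V := isUniformAddGroup_of_addCommGroup
  have : CompleteSpace V := hV.complete
  have : ContinuousSMul K V := hp.continuousSMul
  have : FirstCountableTopology V := hp.firstCountableTopology
  have : (uniformity V).IsCountablyGenerated := IsUniformAddGroup.uniformity_countably_generated
  infer_instance

/-- Hahn--Banach: a continuous seminorm is attained at a given vector by a form it dominates. -/
theorem exists_eq_of_continuous_seminorm [PolynormableSpace K V]
    {q : Seminorm K V} (hq : Continuous q) (v : V) :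
    ∃ μ : V →L[K] K, (∀ w, ‖μ w‖ ≤ q w) ∧ ‖μ v‖ = q v := by
  by_cases hv : v = 0
  · exact ⟨0, fun w => by simp, by simp [hv]⟩
  let f : Module.Dual K (K ∙ v) := (q v : K) • (LinearEquiv.coord K V v hv : (K ∙ v) →ₗ[K] K)
  have hf : ∀ x : K ∙ v, ‖f x‖ = q x := fun x => by
    conv_rhs => rw [← LinearEquiv.coord_apply_smul K V v hv x]
    rw [map_smul_eq_mul, mul_comm]
    change ‖(q v : K) * LinearEquiv.coord K V v hv x‖ = _
    rw [norm_mul, RCLike.norm_of_nonneg (apply_nonneg q v)]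
  obtain ⟨μ, h1, h2⟩ :=
    Module.Dual.exists_continuous_extension_of_le_seminorm (K ∙ v) f hq fun x => (hf x).le
  refine ⟨μ, h2, ?_⟩
  have := h1 ⟨v, Submodule.mem_span_singleton_self v⟩
  rw [this, hf]

end Nuclear

/-! ### Uniform coefficient bounds and summable sequences -/

section Coefficients

/-- Uniform coefficient bounds for the restrictions of the forms dominated by a continuous
seminorm on a nuclear space. -/
theorem exists_coefficient_bound_of_nuclear {K : Type u} [RCLike K] {V : Type (max u v)}
    [AddCommGroup V] [Module K V] [TopologicalSpace V] [IsTopologicalAddGroup V]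
    {X : Type*} [NormedAddCommGroup X] [NormedSpace K X]
    (hV : IsNuclearSpace K V) (j : X →L[K] V)
    {g : ℕ → X →L[K] K} {D : ℝ} (hD : 0 ≤ D) (hg : ∀ n, ‖g n‖ ≤ 1)
    (hrep : ∀ φ : V →L[K] K, ∃ a : ℕ → K, Summable (fun n => ‖a n‖) ∧
      ∑' n, ‖a n‖ ≤ D * ‖φ.comp j‖ ∧ HasSum (fun n => a n • g n) (φ.comp j))
    {q : Seminorm K V} (hq : Continuous q) :
    ∃ l : ℕ → ℝ, Summable l ∧ (∀ n, 0 ≤ l n) ∧ ∀ μ : V →L[K] K, (∀ v, ‖μ v‖ ≤ q v) →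
      ∃ a : ℕ → K, (∀ n, ‖a n‖ ≤ l n) ∧ HasSum (fun n => a n • g n) (μ.comp j) := by
  obtain ⟨c, φ, M, hc, hφ, hM, hexp⟩ := IsNuclearSpace.exists_expansion.{u, v} hV hq
  -- Equicontinuity at 0 and continuity of `j` give one ball in `X` on which all `φ i ∘ j` are
  -- bounded by 1.
  obtain ⟨N, hN0, hN⟩ : ∃ N : ℝ, 0 ≤ N ∧ ∀ i, ‖(φ i).comp j‖ ≤ N := by
    have h1 := hφ 0 _ (Metric.dist_mem_uniformity one_pos)
    have h2 := j.continuous.tendsto 0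
    rw [map_zero] at h2
    obtain ⟨r, hr, hr'⟩ := Metric.eventually_nhds_iff_ball.1 (h2.eventually h1)
    refine ⟨1 / (r / 2), by positivity, fun i => ?_⟩
    refine ContinuousLinearMap.opNorm_le_bound _ (by positivity) fun x => ?_
    refine LinearMap.bound_of_ball_bound' (half_pos hr) 1 ((φ i).comp j : X →ₗ[K] K) (fun z hz => ?_) x
    have := hr' z (Metric.closedBall_subset_ball (half_lt_self hr) hz) i
    simpa using (show dist (φ i 0) (φ i (j z)) < 1 from this).le
  choose a ha1 ha2 ha3 using fun i => hrep (φ i)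
  obtain ⟨hS, hS', hcol⟩ := summable_double_of_row_le (F := fun i n => ‖c i‖ * ‖a i n‖)
    (s := fun i => ‖c i‖ * (D * N)) (fun i n => by positivity) (fun i => (ha1 i).mul_left _)
    (hc.mul_right (D * N)) (fun i => by
      rw [tsum_mul_left]
      gcongr
      exact (ha2 i).trans (by gcongr; exact hN i))
  refine ⟨fun n => M * ∑' i, ‖c i‖ * ‖a i n‖, hS'.mul_left M,
    fun n => mul_nonneg hM (tsum_nonneg fun i => by positivity), fun μ hμ => ?_⟩
  obtain ⟨y, hy, hsum⟩ := hexp μ hμ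
  have hle : ∀ i n, ‖c i * y i * a i n‖ ≤ M * (‖c i‖ * ‖a i n‖) := fun i n => by
    rw [norm_mul, norm_mul]
    calc ‖c i‖ * ‖y i‖ * ‖a i n‖ ≤ ‖c i‖ * M * ‖a i n‖ := by gcongr; exact hy i
      _ = M * (‖c i‖ * ‖a i n‖) := by ring
  refine ⟨fun n => ∑' i, c i * y i * a i n, fun n => ?_, ?_⟩
  · dsimp only
    rw [← tsum_mul_left]
    exact tsum_of_norm_bounded ((hcol n).mul_left M).hasSum fun i => hle i n
  · refine hasSum_smul_of_hasSum_hasSum (Y := X →L[K] K) (b := fun i n => c i * y i * a i n)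
      (z := fun i => (c i * y i) • (φ i).comp j) hg
      (Summable.of_nonneg_of_le (fun p => norm_nonneg _) (fun p => hle p.1 p.2)
        (hS.mul_left M)) (fun i => ?_) ?_
    · simpa only [mul_smul] using (ha3 i).const_smul (c i * y i)
    · have hz : Summable fun i => (c i * y i) • (φ i).comp j := by
        refine Summable.of_norm_bounded (hc.mul_right (M * N)) fun i => ?_
        rw [norm_smul, norm_mul, mul_assoc]
        gcongr
        exacts [hy i, hN i]
      -- Nuclearity gives only pointwise convergence to `μ`; the norm-convergent series is
      -- identified by evaluating at each `x`.
      suffices h : μ.comp j = ∑' i, (c i * y i) • (φ i).comp j by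
        rw [h]
        exact hz.hasSum
      ext x
      let ev : (X →L[K] K) →L[K] K := ContinuousLinearMap.apply K K x
      refine (hsum (j x)).unique ?_
      convert ev.hasSum hz.hasSum using 2 with i
      · change _ = c i * y i * φ i (j x)
        ring
      · rfl

/-- Countably many nonnegative summable sequences are dominated, up to constants, by a single
positive summable sequence. -/
theorem exists_summable_dominating {l : ℕ → ℕ → ℝ} (hl : ∀ k, Summable (l k))
    (h0 : ∀ k n, 0 ≤ l k n) :
    ∃ m : ℕ → ℝ, Summable m ∧ (∀ n, 0 < m n) ∧ ∀ k, ∃ C : ℝ, 0 ≤ C ∧ ∀ n, l k n ≤ C * m n := by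
  have hS : ∀ k, 0 ≤ ∑' n, l k n := fun k => tsum_nonneg (h0 k)
  -- These weights make the `k`-th weighted row sum at most `2⁻ᵏ`; the `1 +` avoids a zero
  -- denominator.
  let w : ℕ → ℝ := fun k => (1 / 2) ^ k / (1 + ∑' n, l k n)
  have hw : ∀ k, 0 < w k := fun k => div_pos (by positivity) (by linarith [hS k])
  have hnn : ∀ k n, 0 ≤ w k * l k n := fun k n => mul_nonneg (hw _).le (h0 _ _)
  obtain ⟨-, hs, hcol⟩ := summable_double_of_row_le (F := fun k n => w k * l k n)
    (s := fun k => (1 / 2) ^ k) hnn (fun k => (hl k).mul_left _) summable_geometric_two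
    (fun k => by
      rw [tsum_mul_left, div_mul_eq_mul_div, div_le_iff₀ (by linarith [hS k])]
      gcongr
      linarith)
  -- The added geometric term forces strict positivity.
  refine ⟨fun n => ∑' k, w k * l k n + (1 / 2) ^ n, hs.add summable_geometric_two,
    fun n => add_pos_of_nonneg_of_pos (tsum_nonneg fun k => hnn k n) (by positivity),
    fun k => ⟨(w k)⁻¹, (inv_pos.2 (hw k)).le, fun n => ?_⟩⟩
  rw [inv_mul_eq_div, le_div_iff₀ (hw k), mul_comm]
  have h1 := (hcol n).le_tsum k fun i _ => hnn i n
  have h2 : (0 : ℝ) ≤ (1 / 2) ^ n := by positivity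
  linarith

/-- A positive summable sequence stays summable after division by a suitable strictly decreasing
null sequence. -/
theorem exists_strictAnti_summable_div {l : ℕ → ℝ} (hl : Summable l) (h0 : ∀ n, 0 < l n) :
    ∃ ε : ℕ → ℝ, StrictAnti ε ∧ Filter.Tendsto ε Filter.atTop (nhds 0) ∧
      Summable fun n => l n / ε n := by
  let r : ℕ → ℝ := fun n => ∑' k, l (k + n)
  have hr : ∀ n, r n = l n + r (n + 1) := fun n => by
    have := ((summable_nat_add_iff n).2 hl).tsum_eq_zero_add
    simp only [zero_add] at this
    simp only [r, this]
    congr 2 with k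
    congr 1
    ring
  have hr0 : ∀ n, 0 < r n := fun n =>
    ((summable_nat_add_iff n).2 hl).tsum_pos (fun k => (h0 _).le) 0 (h0 _)
  have hlim : Filter.Tendsto (fun n => √(r n)) Filter.atTop (nhds 0) := by
    have := (Real.continuous_sqrt.tendsto 0).comp (tendsto_sum_nat_add l)
    rwa [Real.sqrt_zero] at this
  have hanti : StrictAnti fun n => √(r n) := strictAnti_nat_of_succ_lt fun n =>
    Real.sqrt_lt_sqrt (hr0 _).le (by linarith [hr n, h0 n])
  refine ⟨fun n => √(r n), hanti, hlim, ?_⟩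
  -- With `ε n = √(r n)` for the tails `r`, `l n = r n - r (n + 1)` factors as a difference of
  -- squares, whence a telescoping bound.
  have hle : ∀ n, l n / √(r n) ≤ 2 * (√(r n) - √(r (n + 1))) := fun n => by
    have h1 := Real.sq_sqrt (hr0 n).le
    have h2 := Real.sq_sqrt (hr0 (n + 1)).le
    have h3 : √(r (n + 1)) ≤ √(r n) := (hanti (Nat.lt_succ_self n)).le
    rw [div_le_iff₀ (Real.sqrt_pos.2 (hr0 n))]
    nlinarith [hr n, Real.sqrt_nonneg (r n), Real.sqrt_nonneg (r (n + 1))]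
  refine summable_of_sum_range_le (c := 2 * √(r 0))
    (fun n => div_nonneg (h0 n).le (Real.sqrt_nonneg _)) fun n => ?_
  calc ∑ i ∈ Finset.range n, l i / √(r i)
      ≤ ∑ i ∈ Finset.range n, 2 * (√(r i) - √(r (i + 1))) := Finset.sum_le_sum fun i _ => hle i
    _ = 2 * (√(r 0) - √(r n)) := by
      rw [← Finset.mul_sum, Finset.sum_range_sub' (fun i => √(r i))]
    _ ≤ 2 * √(r 0) := by linarith [Real.sqrt_nonneg (r n)]

end Coefficients

/-! ### One dominating sequence, and the weighted supremum estimate -/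

section Representation

/-- Restrictions to `X` of continuous linear forms on a nuclear Fréchet space `V` in which the unit
ball of `X` is compact: they are series in a norming sequence, with coefficients dominated by a
single summable sequence up to a constant depending on a continuous seminorm. -/
theorem exists_summable_representation {K : Type u} [RCLike K] {V : Type (max u v)}
    [AddCommGroup V] [Module K V] [TopologicalSpace V] [IsTopologicalAddGroup V]
    {X : Type*} [NormedAddCommGroup X] [NormedSpace K X]
    (hF : IsFrechet K V) (hN : IsNuclearSpace K V) (j : X →L[K] V)
    (hj : IsCompact (j '' Metric.closedBall 0 1))
    {g : ℕ → X →L[K] K} {C : ℝ} (hC : 0 ≤ C) (hg : ∀ n, ‖g n‖ ≤ 1)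
    (hfix : ∀ f : X, ‖f‖ ≤ C * ⨆ n, ‖g n f‖)
    (hgj : ∀ n, ∃ t : V →L[K] K, g n = t.comp j) :
    ∃ l : ℕ → ℝ, Summable l ∧ (∀ n, 0 < l n) ∧ ∀ q : Seminorm K V, Continuous q →
      ∃ C : ℝ, 1 ≤ C ∧ ∀ μ : V →L[K] K, (∀ v, ‖μ v‖ ≤ q v) →
        ∃ a : ℕ → K, Summable (fun n => ‖a n‖) ∧ (∀ n, ‖a n‖ ≤ C * l n) ∧
          HasSum (fun n => a n • g n) (μ.comp j) := by
  obtain ⟨p, hp⟩ := hF.exists_seminorms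
  -- Finite suprema of the `p i` dominate every continuous seminorm up to a constant.
  let q : ℕ → Seminorm K V := fun k => (Finset.range k).sup p
  have hq : ∀ k, Continuous (q k) := fun k =>
    Seminorm.continuous_finsetSup fun i _ => hp.continuous_seminorm i
  choose l hl1 hl2 hl3 using fun k => exists_coefficient_bound_of_nuclear.{u, v} hN j
    (mul_nonneg zero_le_two hC) hg (exists_hasSum_smul_of_isCompact j hj hC hg hfix hgj) (hq k)
  obtain ⟨m, hm, hm0, hdom⟩ := exists_summable_dominating hl1 hl2
  refine ⟨m, hm, hm0, fun r hr => ?_⟩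
  obtain ⟨s, D, -, hsD⟩ := Seminorm.bound_of_continuous hp r hr
  obtain ⟨k, hk⟩ := s.exists_nat_subset_range
  obtain ⟨M, hM, hlM⟩ := hdom k
  refine ⟨max 1 ((D + 1) * M), le_max_left _ _, fun μ hμ => ?_⟩
  -- `D` may vanish, so `μ` is rescaled by `D + 1` to be dominated by `q k`.
  have hD : (0 : ℝ) < D + 1 := by positivity
  have hDK : ((D + 1 : ℝ) : K) ≠ 0 := by exact_mod_cast hD.ne'
  obtain ⟨a, ha, hsum⟩ := hl3 k (((D + 1 : ℝ) : K)⁻¹ • μ) fun v => by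
    change ‖((D + 1 : ℝ) : K)⁻¹ • μ v‖ ≤ q k v
    rw [norm_smul, norm_inv, RCLike.norm_of_nonneg hD.le, inv_mul_le_iff₀ hD]
    have h1 : r v ≤ D * s.sup p v := hsD v
    have h2 : s.sup p v ≤ q k v := (Finset.sup_mono hk : s.sup p ≤ q k) v
    have h3 : (D : ℝ) * s.sup p v ≤ D * q k v := by gcongr
    linarith [hμ v, apply_nonneg (q k) v]
  have hbound : ∀ n, ‖((D + 1 : ℝ) : K) * a n‖ ≤ max 1 ((D + 1) * M) * m n := fun n => by
    rw [norm_mul, RCLike.norm_of_nonneg hD.le]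
    calc (D + 1) * ‖a n‖ ≤ (D + 1) * (M * m n) := by gcongr; exact (ha n).trans (hlM n)
      _ = (D + 1) * M * m n := by ring
      _ ≤ _ := mul_le_mul_of_nonneg_right (le_max_right _ _) (hm0 n).le
  refine ⟨fun n => ((D + 1 : ℝ) : K) * a n,
    Summable.of_nonneg_of_le (fun n => norm_nonneg _) hbound (hm.mul_left _), hbound, ?_⟩
  have h := hsum.const_smul ((D + 1 : ℝ) : K)
  rw [ContinuousLinearMap.smul_comp, smul_smul, mul_inv_cancel₀ hDK, one_smul] at h
  simpa only [mul_smul] using h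

/-- A continuous seminorm is controlled by a weighted supremum along the norming sequence. -/
theorem exists_seminorm_le_iSup {K : Type*} [RCLike K] {V : Type*}
    [AddCommGroup V] [Module K V] [TopologicalSpace V] [PolynormableSpace K V]
    {X : Type*} [NormedAddCommGroup X] [NormedSpace K X] (j : X →L[K] V)
    {g : ℕ → X →L[K] K} (hg : ∀ n, ‖g n‖ ≤ 1) {l ε : ℕ → ℝ} (hl : ∀ n, 0 ≤ l n)
    (hε : StrictAnti ε) (hε0 : ∀ n, 0 < ε n) (hs : Summable fun n => l n / ε n)
    {q : Seminorm K V} (hq : Continuous q) {C : ℝ} (hC : 0 ≤ C)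
    (hrep : ∀ μ : V →L[K] K, (∀ v, ‖μ v‖ ≤ q v) → ∃ a : ℕ → K, (∀ n, ‖a n‖ ≤ C * l n) ∧
      HasSum (fun n => a n • g n) (μ.comp j)) :
    ∃ C' : ℝ, 1 ≤ C' ∧ ∀ f : X, q (j f) ≤ C' * ⨆ n, ‖g n f‖ * ε n := by
  refine ⟨max 1 (C * ∑' n, l n / ε n), le_max_left _ _, fun f => ?_⟩
  -- A real supremum of an unbounded family is 0 by default, so boundedness must be proved before
  -- terms are compared with it.
  have hbdd : BddAbove (Set.range fun n => ‖g n f‖ * ε n) := by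
    refine ⟨‖f‖ * ε 0, ?_⟩
    rintro _ ⟨n, rfl⟩
    have h1 : ‖g n f‖ ≤ ‖f‖ := by simpa using (g n).le_of_opNorm_le (hg n) f
    exact mul_le_mul h1 (hε.antitone (Nat.zero_le n)) (hε0 n).le (norm_nonneg f)
  have hS : 0 ≤ ⨆ n, ‖g n f‖ * ε n :=
    Real.iSup_nonneg fun n => mul_nonneg (norm_nonneg _) (hε0 n).le
  obtain ⟨μ, hμ, hμf⟩ := exists_eq_of_continuous_seminorm hq (j f)
  obtain ⟨a, ha, hsum⟩ := hrep μ hμ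
  let ev : (X →L[K] K) →L[K] K := ContinuousLinearMap.apply K K f
  have h1 : HasSum (fun n => a n * g n f) (μ (j f)) := ev.hasSum hsum
  have h2 := (hs.hasSum.mul_left C).mul_right (⨆ n, ‖g n f‖ * ε n)
  rw [← hμf]
  refine (h1.norm_le_of_bounded h2 fun n => ?_).trans
    (mul_le_mul_of_nonneg_right (le_max_right _ _) hS)
  rw [norm_mul]
  calc ‖a n‖ * ‖g n f‖ ≤ C * l n * ‖g n f‖ := by gcongr; exact ha n
    _ = C * (l n / ε n) * (‖g n f‖ * ε n) := by
      have := (hε0 n).ne'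
      field_simp
    _ ≤ _ := by
      refine mul_le_mul_of_nonneg_left (le_ciSup hbdd n) ?_
      exact mul_nonneg hC (div_nonneg (hl n) (hε0 n).le)

end Representation

theorem mainTheorem10 {K : Type u} [RCLike K]
    {Ω : Type v} {ω : Type w} [Nonempty Ω] [Nonempty ω]
    (𝓕 : ∀ (E : Type u) [NormedAddCommGroup E] [NormedSpace K E] [CompleteSpace E]
      [Nontrivial E], FunctionSpace K Ω ω E)
    (ν : ω → Set.Ioi (0 : ℝ))
    (hcompat : ∀ (E : Type u) [NormedAddCommGroup E] [NormedSpace K E] [CompleteSpace E]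
      [Nontrivial E], EpsIntoCompatible (𝓕 K) (𝓕 E))
    (hgen : ∀ (E : Type u) [NormedAddCommGroup E] [NormedSpace K E] [CompleteSpace E]
      [Nontrivial E], IsGenerator (𝓕 K) (𝓕 E) ν)
    (hstrong : ∀ (E : Type u) [NormedAddCommGroup E] [NormedSpace K E] [CompleteSpace E]
      [Nontrivial E], IsStrongFamily (𝓕 K) (𝓕 E))
    (hcons : ∀ (E : Type u) [NormedAddCommGroup E] [NormedSpace K E] [CompleteSpace E]
      [Nontrivial E], IsConsistentFamily (𝓕 K) (𝓕 E))
    (hfrechet : IsFrechet K (𝓕 K).Carrier)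
    (hnuclear : IsNuclearSpace K (𝓕 K).Carrier)
    (hbanach : CompleteSpace ((𝓕 K).Weighted ν))
    (hball : IsCompact ((𝓕 K).unitBall ν))
    (x : ℕ → ω)
    (hx : (𝓕 K).FixesTopology ν (Set.range x)) :
    (∃ l : ℕ → ℝ, Summable l ∧ (∀ n, 0 < l n) ∧
      ∀ B : Set ((𝓕 K).Carrier →L[K] K), Bornology.IsVonNBounded K B →
        ∃ C : ℝ, 1 ≤ C ∧
          (fun μ : (𝓕 K).Carrier →L[K] K => (μ : (𝓕 K).Carrier →ₗ[K] K) ∘ₗ (𝓕 K).incl ν) '' B ⊆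
          (fun φ : (𝓕 K).Weighted ν →L[K] K => (φ : (𝓕 K).Weighted ν →ₗ[K] K)) ''
            {φ | ∃ a : ℕ → K, Summable (fun n => ‖a n‖) ∧ (∀ n, ‖a n‖ ≤ C * l n) ∧
              HasSum (fun n => (a n * ((ν (x n) : ℝ) : K)) • (𝓕 K).weightedOpAt ν (x n)) φ}) ∧
    (∀ p : ℕ → Seminorm K (𝓕 K).Carrier, WithSeminorms p →
      ∃ ε : ℕ → ℝ, StrictAnti ε ∧ Filter.Tendsto ε Filter.atTop (nhds 0) ∧
        ∀ k, ∃ C : ℝ, 1 ≤ C ∧ ∀ f : (𝓕 K).Weighted ν,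
          p k ((𝓕 K).incl ν f) ≤
            C * ⨆ n, ‖(𝓕 K).op ((𝓕 K).incl ν f) (x n)‖ * (ν (x n) : ℝ) * ε n) := by
  have hT2 : T2Space ((𝓕 K).Weighted ν) := (hgen K).t2Space_scalar
  let : NormedAddCommGroup ((𝓕 K).Weighted ν) :=
    { (inferInstance : SeminormedAddCommGroup ((𝓕 K).Weighted ν)) with
      eq_of_dist_eq_zero := fun h => (Metric.inseparable_iff.2 h).eq }
  obtain ⟨-, hT, -⟩ := hcons K
  let j : (𝓕 K).Weighted ν →L[K] (𝓕 K).Carrier :=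
    -- Compact sets are bounded, which makes the inclusion continuous.
    ⟨(𝓕 K).incl ν, continuous_of_isCompact_image_closedBall _ hball⟩
  let g : ℕ → (𝓕 K).Weighted ν →L[K] K := fun n =>
    ((ν (x n) : ℝ) : K) • (𝓕 K).weightedOpAt ν (x n)
  have hν : ∀ y, (0 : ℝ) < ν y := fun y => (ν y).2
  have hgf : ∀ n f, ‖g n f‖ = ‖(𝓕 K).op ((𝓕 K).incl ν f) (x n)‖ * (ν (x n) : ℝ) := fun n f => by
    change ‖((ν (x n) : ℝ) : K) • (𝓕 K).op ((𝓕 K).incl ν f) (x n)‖ = _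
    rw [norm_smul, RCLike.norm_of_nonneg (hν _).le, mul_comm]
  have hg : ∀ n, ‖g n‖ ≤ 1 := fun n =>
    ContinuousLinearMap.opNorm_le_bound _ zero_le_one fun f => by
      rw [hgf, one_mul]
      exact le_ciSup ((𝓕 K).bddAbove_weighted ν f) (x n)
  obtain ⟨C₀, hC₀, hx⟩ := hx
  have hfix : ∀ f, ‖f‖ ≤ C₀ * ⨆ n, ‖g n f‖ := fun f => by
    refine (hx f).trans (le_of_eq ?_)
    simp only [hgf]
    rw [← Set.rangeFactorization_surjective.iSup_comp]
    rfl
  have hgj : ∀ n, ∃ t : (𝓕 K).Carrier →L[K] K, g n = t.comp j := fun n =>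
    ⟨((ν (x n) : ℝ) : K) • ⟨(𝓕 K).opAt (x n), hT (x n)⟩, rfl⟩
  obtain ⟨l, hl, hl0, hrep⟩ := exists_summable_representation.{u, v} hfrechet hnuclear j hball
    hC₀.le hg hfix hgj
  refine ⟨⟨l, hl, hl0, fun B hB => ?_⟩, fun p hp => ?_⟩
  · have : BarrelledSpace K (𝓕 K).Carrier := hfrechet.barrelledSpace
    -- Evaluation at `v` is continuous on the strong dual, so `B` is pointwise bounded, hence
    -- dominated by one continuous seminorm.
    obtain ⟨q, hq, hqB⟩ := exists_continuous_seminorm_of_pointwise_bounded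
      (fun μ : B => μ.1) fun v => by
        let ev : ((𝓕 K).Carrier →L[K] K) →L[K] K :=
          { toFun := fun μ => μ v
            map_add' := fun _ _ => rfl
            map_smul' := fun _ _ => rfl
            cont := continuous_eval_const v }
        have h1 := hB.image ev
        obtain ⟨r, hr⟩ := ((NormedSpace.isVonNBounded_iff K).1 h1).exists_norm_le
        refine ⟨r, ?_⟩
        rintro _ ⟨μ, rfl⟩
        exact hr _ ⟨μ.1, μ.2, rfl⟩
    obtain ⟨C, hC, hCq⟩ := hrep q hq
    refine ⟨C, hC, ?_⟩
    rintro _ ⟨μ, hμ, rfl⟩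
    obtain ⟨a, ha1, ha2, ha3⟩ := hCq μ (hqB ⟨μ, hμ⟩)
    refine ⟨μ.comp j, ⟨a, ha1, ha2, ?_⟩, rfl⟩
    simpa only [g, smul_smul] using ha3
  · obtain ⟨ε, hε, hε1, hs⟩ := exists_strictAnti_summable_div hl hl0
    -- A decreasing null sequence has `0 ≤ ε (n + 1)`, and strictness gives `ε (n + 1) < ε n`.
    have hε0 : ∀ n, 0 < ε n := fun n =>
      (hε.antitone.le_of_tendsto hε1 (n + 1)).trans_lt (hε (Nat.lt_succ_self n))
    refine ⟨ε, hε, hε1, fun k => ?_⟩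
    have hk := hp.continuous_seminorm k
    obtain ⟨C, hC, hCq⟩ := hrep (p k) hk
    obtain ⟨C', hC', h⟩ := exists_seminorm_le_iSup j hg (fun n => (hl0 n).le) hε hε0 hs hk
      (zero_le_one.trans hC) fun μ hμ => (hCq μ hμ).imp fun a ha => ha.2
    refine ⟨C', hC', fun f => ?_⟩
    have hf := h f
    simp only [hgf] at hf
    exact hf
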